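/- Let $d,k\ge 0$ be integers, $T<\infty$, $x_0\in\mathbf{R}^d$ a constant vector, $l_1,\dots,l_k\in\mathbf{Z}^d$, and let $f_1,\dots,f_k:[0,T]\times\mathbf{R}^d\to\mathbf{R}$ be continuous functions such that $|f_i(t,x)|\le C_i(1+|x|)$ for all $t\in[0,T]$, $x\in\mathbf{R}^d$, with constants $C_i<\infty$. Let $Y_1,\dots,Y_k$ be independent rate $1$ Poisson processes on a probability space, and let $X=(X(t))_{0\le t\le T}$ be an $\mathbf{R}^d$-valued stochastic process on the same space which solves, almost surely for all $t\in[0,T]$, \[ X(t)=x_0+\sum_{i=1}^k l_i\,Y_i\Big(\int_0^t f_i\big(s,X(s)\big)\,ds\Big), \] where, almost surely, the rates $s\mapsto f_i(s,X(s))$ along the path are nonnegative and integrable on $[0,T]$ (so that the time changes are well defined). Then, for every $t\in[0,T]$, $X(t)$ and the $f_i(t,X(t))$ are integrable random variables, the functions $s\mapsto E[f_i(s,X(s))]$ are integrable on $[0,t]$, and \[ E\big[X(t)\big]=x_0+\sum_{i=1}^k l_i\int_0^t E\Big[f_i\big(s,X(s)\big)\Big]\,ds. \] -/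

import Mathlib

open MeasureTheory ProbabilityTheory Set
open scoped NNReal

/-- `Y` is a (homogeneous) Poisson process of rate `r` under `P`: a counting process indexed by
`[0, ∞)` that starts at `0`, has independent increments, has Poisson distributed increments
`Y t - Y s ~ Poisson (r (t - s))` for `s ≤ t`, and almost surely has nondecreasing
right-continuous paths (left limits then exist automatically, and by monotonicity the truncated
subtraction of `ℕ` is the usual one almost surely). -/
structure IsPoissonProcess {Ω : Type*} [MeasurableSpace Ω] (Y : ℝ≥0 → Ω → ℕ) (r : ℝ≥0)
    (P : Measure Ω) : Prop where
  measurable : ∀ t, Measurable (Y t)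
  zero : ∀ᵐ ω ∂P, Y 0 ω = 0
  indep : HasIndepIncrements Y P
  law : ∀ s t, s ≤ t → HasLaw (fun ω => Y t ω - Y s ω) (poissonMeasure (r * (t - s))) P
  monotone : ∀ᵐ ω ∂P, Monotone fun t => Y t ω
  right_continuous : ∀ᵐ ω ∂P, ∀ t, ContinuousWithinAt (fun u => Y u ω) (Ici t) t

/-- An integer vector, seen as a vector of Euclidean space. -/
noncomputable def intVec {d : ℕ} (v : Fin d → ℤ) : EuclideanSpace ℝ (Fin d) :=
  WithLp.toLp 2 fun j => (v j : ℝ)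

/-- `X` is a solution on `[0, T]` of the random time change equation
`X(t) = x₀ + ∑ i, l i * Y i (∫₀ᵗ f i (s, X(s)) ds)`: it is a stochastic process for which, almost
surely, the rates along the path are nonnegative and integrable over `[0, T]` (so that the
integrals in the equation are genuine and are times in `[0, ∞)`), and the equation holds
simultaneously for all `t ∈ [0, T]`. -/
structure IsTimeChangeSolution {Ω : Type*} [MeasurableSpace Ω] (P : Measure Ω) {d k : ℕ}
    (T : ℝ) (x₀ : EuclideanSpace ℝ (Fin d)) (l : Fin k → Fin d → ℤ)
    (f : Fin k → ℝ → EuclideanSpace ℝ (Fin d) → ℝ) (Y : Fin k → ℝ≥0 → Ω → ℕ)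
    (X : ℝ → Ω → EuclideanSpace ℝ (Fin d)) : Prop where
  measurable : ∀ t ∈ Icc 0 T, Measurable (X t)
  rate_nonneg : ∀ᵐ ω ∂P, ∀ i, ∀ t ∈ Icc 0 T, 0 ≤ f i t (X t ω)
  rate_integrable : ∀ᵐ ω ∂P, ∀ i, IntegrableOn (fun s => f i s (X s ω)) (Icc 0 T)
  equation : ∀ᵐ ω ∂P, ∀ t ∈ Icc 0 T,
    X t ω = x₀ + ∑ i, (Y i (∫ s in (0 : ℝ)..t, f i s (X s ω)).toNNReal ω : ℝ) • intVec (l i)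

/-! Write `τ i` for the internal clock of channel `i` at a fixed time `t`. The claim reduces to `E[Y
i (τ i)] = E[τ i]`, followed by Fubini. For a fixed level `u`, whether `u ≤ τ i` is decided by `Y i`
stopped at `u` together with all the other channels: until clock `i` reaches `u`, the path has used
nothing else. This event is therefore independent of `Y i (u + h) - Y i u`, and optional stopping
follows by rounding `τ i` up to a grid (`IsPoissonProcess.lintegral_comp_eq`). No filtration is
needed, only this independence.

To make "decided by" a measurable statement, the path is rebuilt explicitly from the driving paths.
Between events the state is constant, so a solution is found event by event, without any Lipschitz
condition (`approxSolution_eq_of_totalCount_le`). With truncated rates and regularized driving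
paths, each step is a measurable functional, and `le_internalClock_iff` expresses the event through
it. The same construction yields joint measurability of `X` in time and `ω`.

Integrability comes from `Y i v ≤ 2 * v + W` for all `v` with `W` integrable
(`IsPoissonProcess.exists_linear_bound`). Linear growth and Gronwall then bound the whole path by `K
* (1 + V)`, where `V` is the sum of the `W`'s (`exists_bound_of_linear_growth`). -/

/-! ### Pathwise construction of solutions, event by event. -/

section TimeChange

open Filter Topology

variable {ι E W : Type*}

/-- The internal clock `∫₀ᵗ F j (s, Z s) ds` of channel `j` along the path `Z`. -/
noncomputable def internalClock (F : ι → ℝ → E → ℝ) (Z : ℝ → E) (j : ι) (t : ℝ) : ℝ :=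
  ∫ s in (0 : ℝ)..t, F j s (Z s)

theorem internalClock_monoOn {F : ι → ℝ → E → ℝ} {X : ℝ → E} {S : ℝ} {j : ι}
    (hXi : IntervalIntegrable (fun s => F j s (X s)) volume 0 S)
    (h0 : ∀ s ∈ Icc 0 S, 0 ≤ F j s (X s)) : MonotoneOn (internalClock F X j) (Icc 0 S) := by
  intro a ha b hb hab
  have hXi' : ∀ c ∈ Icc 0 S, IntervalIntegrable (fun s => F j s (X s)) volume 0 c := fun c hc =>
    hXi.mono_set (by
      rw [uIcc_of_le (ha.1.trans ha.2)]
      exact uIcc_subset_Icc ⟨le_rfl, ha.1.trans ha.2⟩ hc)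
  rw [← sub_nonneg, internalClock, internalClock, intervalIntegral.integral_interval_sub_left
    (hXi' _ hb) (hXi' _ ha)]
  exact intervalIntegral.integral_nonneg hab fun s hs => h0 _ ⟨ha.1.trans hs.1, hs.2.trans hb.2⟩

theorem internalClock_continuousOn {F : ι → ℝ → E → ℝ} {X : ℝ → E} {S : ℝ} {j : ι} (hS : 0 ≤ S)
    (hXi : IntervalIntegrable (fun s => F j s (X s)) volume 0 S) :
    ContinuousOn (internalClock F X j) (Icc 0 S) := by
  have := intervalIntegral.continuousOn_primitive_interval
    (μ := volume) (a := 0) (b := S) (f := fun s => F j s (X s))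
    ((intervalIntegrable_iff' (f := fun s => F j s (X s)) (a := 0) (b := S)).1 hXi)
  rwa [uIcc_of_le hS] at this

theorem intervalIntegrable_rate [MeasurableSpace E] {F : ℝ → E → ℝ} {M : ℝ}
    (hF : Measurable (Function.uncurry F)) (hF0 : ∀ s x, 0 ≤ F s x)
    (hFM : ∀ s x, F s x ≤ M) {Z : ℝ → E} (hZ : Measurable Z)
    (a b : ℝ) :
    IntervalIntegrable (fun s => F s (Z s)) volume a b := by
  refine (intervalIntegrable_const (c := M)).mono_fun
    (hF.comp (measurable_id.prodMk hZ)).aestronglyMeasurable ?_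
  refine Eventually.of_forall fun s => ?_
  dsimp only
  rw [Real.norm_of_nonneg (hF0 _ _)]
  exact (hFM _ _).trans (le_abs_self M)

theorem internalClock_mono [MeasurableSpace E] {F : ι → ℝ → E → ℝ} {M : ℝ} {j : ι}
    (hF : Measurable (Function.uncurry (F j))) (hF0 : ∀ s x, 0 ≤ F j s x)
    (hFM : ∀ s x, F j s x ≤ M) {Z : ℝ → E} (hZ : Measurable Z) :
    Monotone (internalClock F Z j) := by
  intro a b hab
  have hZi := intervalIntegrable_rate hF hF0 hFM hZ
  rw [← sub_nonneg, internalClock, internalClock,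
    intervalIntegral.integral_interval_sub_left (hZi _ _) (hZi _ _)]
  exact intervalIntegral.integral_nonneg hab fun s _ => hF0 _ _

/-- The variable limit is moved into an indicator on the product space, so that measurability of
parameter integrals applies. -/
theorem measurable_intervalIntegral_param [MeasurableSpace W] {g : ℝ × W → ℝ} (hg : Measurable g) :
    Measurable fun p : ℝ × W => ∫ s in (0 : ℝ)..p.1, g (s, p.2) := by
  have key : ∀ A : Set (ℝ × (ℝ × W)), MeasurableSet A →
      Measurable fun p : ℝ × W => ∫ s, A.indicator (fun q => g (q.1, q.2.2)) (s, p) := by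
    intro A hA
    have h : Measurable fun q : (ℝ × W) × ℝ =>
        A.indicator (fun q => g (q.1, q.2.2)) (q.2, q.1) :=
      ((hg.comp (by fun_prop)).indicator hA).comp (by fun_prop)
    exact (h.stronglyMeasurable.integral_prod_right' (ν := volume)).measurable
  have h1 := key {q | 0 < q.1 ∧ q.1 ≤ q.2.1} (by measurability)
  have h2 := key {q | q.2.1 < q.1 ∧ q.1 ≤ 0} (by measurability)
  convert h1.sub h2 using 1
  ext p
  simp only [intervalIntegral, Pi.sub_apply]
  rw [← integral_indicator measurableSet_Ioc, ← integral_indicator measurableSet_Ioc]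
  rfl

theorem measurable_internalClock [MeasurableSpace E] [MeasurableSpace W] {F : ι → ℝ → E → ℝ}
    (hF : ∀ j, Measurable (Function.uncurry (F j))) {Z : ℝ × W → E} (hZ : Measurable Z) (j : ι) :
    Measurable fun p : ℝ × W => internalClock F (fun s => Z (s, p.2)) j p.1 :=
  measurable_intervalIntegral_param (g := fun q => F j q.1 (Z q))
    ((hF j).comp (measurable_fst.prodMk hZ))

theorem measurable_comp_clock [MeasurableSpace W] {y : W → ι → ℝ≥0 → ℕ}
    (hy : ∀ j, Measurable fun p : ℝ≥0 × W => y p.2 j p.1) (j : ι) {c : ℝ × W → ℝ}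
    (hc : Measurable c) : Measurable fun p : ℝ × W => y p.2 j (c p).toNNReal :=
  (hy j).comp (hc.real_toNNReal.prodMk measurable_snd)

variable [Fintype ι]

/-- The total number of events counted by `y` up to time `t` when the internal clocks run along
the path `Z`. -/
noncomputable def totalCount (F : ι → ℝ → E → ℝ) (y : ι → ℝ≥0 → ℕ) (Z : ℝ → E) (t : ℝ) : ℕ :=
  ∑ j, y j (internalClock F Z j t).toNNReal

/-- The internal clock along `Z`, switched off once more than `n` events have occurred. -/
noncomputable def killedClock (F : ι → ℝ → E → ℝ) (y : ι → ℝ≥0 → ℕ) (Z : ℝ → E) (n : ℕ)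
    (j : ι) (t : ℝ) : ℝ :=
  ∫ s in (0 : ℝ)..t, if totalCount F y Z s ≤ n then F j s (Z s) else 0

variable [NormedAddCommGroup E] [NormedSpace ℝ E]

/-- Successive construction of the solution of the time change equation driven by `y`: the `n`-th
path is correct as long as at most `n` events have occurred. -/
noncomputable def approxSolution (F : ι → ℝ → E → ℝ) (v : ι → E) (x₀ : E) (y : ι → ℝ≥0 → ℕ) :
    ℕ → ℝ → E
  | 0 => fun _ => x₀
  | n + 1 => fun t => x₀ + ∑ j,
      (y j (killedClock F y (approxSolution F v x₀ y n) n j t).toNNReal : ℝ) • v j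

section Measurability

variable [MeasurableSpace W] [MeasurableSpace E] [BorelSpace E] [SecondCountableTopology E]

theorem measurable_approxSolution {F : ι → ℝ → E → ℝ}
    (hF : ∀ j, Measurable (Function.uncurry (F j))) (v : ι → E) (x₀ : E) {y : W → ι → ℝ≥0 → ℕ}
    (hy : ∀ j, Measurable fun p : ℝ≥0 × W => y p.2 j p.1) (n : ℕ) :
    Measurable fun p : ℝ × W => approxSolution F v x₀ (y p.2) n p.1 := by
  induction n with
  | zero => exact measurable_const
  | succ n ih =>
    have hcount : Measurable fun p : ℝ × W =>
        totalCount F (y p.2) (approxSolution F v x₀ (y p.2) n) p.1 :=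
      Finset.measurable_sum _ fun j _ =>
        measurable_comp_clock hy j (measurable_internalClock hF ih j)
    have hclock : ∀ j, Measurable fun p : ℝ × W =>
        killedClock F (y p.2) (approxSolution F v x₀ (y p.2) n) n j p.1 := fun j =>
      measurable_intervalIntegral_param (g := fun q =>
        if totalCount F (y q.2) (approxSolution F v x₀ (y q.2) n) q.1 ≤ n then
          F j q.1 (approxSolution F v x₀ (y q.2) n q.1) else 0)
        (Measurable.ite (measurableSet_le hcount measurable_const)
          ((hF j).comp (measurable_fst.prodMk ih)) measurable_const)
    simp only [approxSolution]
    refine measurable_const.add (Finset.measurable_sum _ fun j _ => Measurable.smul_const ?_ _)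
    exact (measurable_from_top (f := fun m : ℕ => (m : ℝ))).comp
      (measurable_comp_clock hy j (hclock j))

end Measurability

/-- An integer-valued right-continuous function is locally constant to the right, so the infimum of
the times above level `n` is attained. -/
theorem exists_first_gt {g : ℝ → ℕ} {n : ℕ} {r : ℝ} (hr : 0 ≤ r)
    (hg : ∀ s ∈ Icc 0 r, ∀ᶠ q in 𝓝[≥] s, g q = g s) (h : n < g r) :
    ∃ σ ∈ Icc 0 r, n < g σ ∧ ∀ q ∈ Ico 0 σ, g q ≤ n := by
  set A : Set ℝ := {q | q ∈ Icc 0 r ∧ n < g q}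
  have hA : A.Nonempty := ⟨r, ⟨hr, le_rfl⟩, h⟩
  have hb : BddBelow A := ⟨0, fun q hq => hq.1.1⟩
  have hσ : sInf A ∈ Icc 0 r :=
    ⟨le_csInf hA fun q hq => hq.1.1, csInf_le hb ⟨⟨hr, le_rfl⟩, h⟩⟩
  refine ⟨sInf A, hσ, ?_, fun q hq => ?_⟩
  · have hcl : ∃ᶠ q in 𝓝[≥] (sInf A), q ∈ A := by
      have := (isGLB_csInf hA hb).frequently_mem hA
      exact this
    obtain ⟨q, hq, hq'⟩ := (hcl.and_eventually (hg _ hσ)).exists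
    exact hq' ▸ hq.2
  · by_contra! hc
    exact absurd (csInf_le hb ⟨⟨hq.1, hq.2.le.trans hσ.2⟩, hc⟩) (not_le.2 hq.2)

variable [MeasurableSpace E] [BorelSpace E] [SecondCountableTopology E]

theorem measurable_approxSolution_path {F : ι → ℝ → E → ℝ}
    (hF : ∀ j, Measurable (Function.uncurry (F j))) (v : ι → E) (x₀ : E) {y : ι → ℝ≥0 → ℕ}
    (hy : ∀ j, Monotone (y j)) (n : ℕ) : Measurable (approxSolution F v x₀ y n) := by
  have := measurable_approxSolution hF v x₀ (W := Unit) (y := fun _ => y)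
    (fun j => (hy j).measurable.comp measurable_fst) n
  exact this.comp (measurable_id.prodMk (measurable_const (a := ())))

/-- Induction on the number of events. Up to the time `σ` at which the count first exceeds `n`, step
`n` already follows `X`, so it has the right clocks up to and including `σ`. If the count at `r` is
at most `n + 1`, no further event occurs between `σ` and `r`; freezing the clocks at `σ` thus gives
the right counts at `r`. -/
theorem approxSolution_eq_of_totalCount_le {F : ι → ℝ → E → ℝ} {v : ι → E} {x₀ : E}
    {y : ι → ℝ≥0 → ℕ} {M : ℝ}
    (hF : ∀ j, Measurable (Function.uncurry (F j))) (hF0 : ∀ j s x, 0 ≤ F j s x)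
    (hFM : ∀ j s x, F j s x ≤ M) (hy : ∀ j, Monotone (y j))
    (hyr : ∀ j a, ContinuousWithinAt (y j) (Ici a) a) {X : ℝ → E} {S : ℝ}
    (hXi : ∀ j, IntervalIntegrable (fun s => F j s (X s)) volume 0 S)
    (hX : ∀ r ∈ Ico 0 S, X r = x₀ + ∑ j, (y j (internalClock F X j r).toNNReal : ℝ) • v j)
    (n : ℕ) : ∀ r ∈ Ico 0 S, totalCount F y X r ≤ n → approxSolution F v x₀ y n r = X r := by
  have hmono := fun j => internalClock_monoOn (hXi j) fun s _ => hF0 j s (X s)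
  have hNmono : ∀ j, ∀ a ∈ Icc 0 S, ∀ b ∈ Icc 0 S, a ≤ b →
      y j (internalClock F X j a).toNNReal ≤ y j (internalClock F X j b).toNNReal :=
    fun j a ha b hb hab => hy j (Real.toNNReal_mono (hmono j ha hb hab))
  have hrc : ∀ s ∈ Ico 0 S, ∀ᶠ q in 𝓝[≥] s, totalCount F y X q = totalCount F y X s := by
    intro s hs
    have h : ∀ j, ∀ᶠ q in 𝓝[≥] s, y j (internalClock F X j q).toNNReal =
        y j (internalClock F X j s).toNNReal := by
      intro j
      have hmem : Icc 0 S ∈ 𝓝[≥] s :=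
        mem_of_superset (Ico_mem_nhdsGE hs.2) fun q hq => ⟨hs.1.trans hq.1, hq.2.le⟩
      have hc := internalClock_continuousOn (hs.1.trans hs.2.le) (hXi j)
      have h1 : Tendsto (fun q => (internalClock F X j q).toNNReal) (𝓝[≥] s)
          (𝓝[≥] (internalClock F X j s).toNNReal) := by
        refine tendsto_nhdsWithin_iff.2 ⟨?_, ?_⟩
        · refine (continuous_real_toNNReal.tendsto _).comp ?_
          exact ((hc s ⟨hs.1, hs.2.le⟩).mono_of_mem_nhdsWithin hmem).tendsto
        · filter_upwards [hmem, self_mem_nhdsWithin] with q hq hsq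
          exact Real.toNNReal_mono (hmono j ⟨hs.1, hs.2.le⟩ hq hsq)
      have h2 := (hyr j _).tendsto.comp h1
      rw [nhds_discrete] at h2
      exact tendsto_pure.1 h2
    filter_upwards [eventually_all.2 h] with q hq
    simp [totalCount, hq]
  induction n with
  | zero =>
    intro r hr h
    have h0 : ∀ j, y j (internalClock F X j r).toNNReal = 0 := by
      simpa [totalCount] using h
    rw [hX r hr]
    simp [approxSolution, h0]
  | succ n ih =>
    intro r hr h
    set Z := approxSolution F v x₀ y n with hZ
    have hZm : Measurable Z := measurable_approxSolution_path hF v x₀ hy n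
    have hZi := fun j => intervalIntegrable_rate (hF j) (hF0 j) (hFM j) hZm
    have hZmono := fun j => internalClock_mono (hF j) (hF0 j) (hFM j) hZm
    -- Agreement strictly before `σ` suffices for the clocks to agree at `σ` itself, since one point
    -- is null for the integral.
    have hclock : ∀ σ ∈ Icc 0 r, (∀ q ∈ Ico 0 σ, totalCount F y X q ≤ n) → ∀ j,
        ∀ q ∈ Icc 0 σ, internalClock F Z j q = internalClock F X j q := by
      intro σ hσ hσn j q hq
      refine intervalIntegral.integral_congr_ae ?_
      have hne : ∀ᵐ s ∂(volume : Measure ℝ), s ≠ q := by simp [ae_iff]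
      filter_upwards [hne] with s hs hs'
      rw [uIoc_of_le hq.1] at hs'
      have hlt : s < q := lt_of_le_of_ne hs'.2 hs
      rw [ih s ⟨hs'.1.le, (hlt.trans_le (hq.2.trans hσ.2)).trans hr.2⟩
        (hσn s ⟨hs'.1.le, hlt.trans_le hq.2⟩)]
    have hclock' : ∀ σ ∈ Icc 0 r, (∀ q ∈ Ico 0 σ, totalCount F y X q ≤ n) → ∀ j,
        killedClock F y Z n j σ = internalClock F X j σ := by
      intro σ hσ hσn j
      rw [← hclock σ hσ hσn j σ ⟨hσ.1, le_rfl⟩]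
      refine intervalIntegral.integral_congr_ae ?_
      have hne : ∀ᵐ s ∂(volume : Measure ℝ), s ≠ σ := by simp [ae_iff]
      filter_upwards [hne] with s hs hs'
      rw [uIoc_of_le hσ.1] at hs'
      have hlt : s < σ := lt_of_le_of_ne hs'.2 hs
      rw [if_pos]
      have := hσn s ⟨hs'.1.le, hlt⟩
      simp only [totalCount] at this ⊢
      simpa only [hclock σ hσ hσn _ s ⟨hs'.1.le, hs'.2⟩] using this
    have hNr : ∀ q ∈ Icc 0 r, totalCount F y X q ≤ totalCount F y X r := fun q hq =>
      Finset.sum_le_sum fun j _ => hNmono j q ⟨hq.1, hq.2.trans hr.2.le⟩ r ⟨hr.1, hr.2.le⟩ hq.2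
    rw [hX r hr]
    simp only [approxSolution]
    congr 1
    refine Finset.sum_congr rfl fun j _ => ?_
    congr 2
    by_cases hn : totalCount F y X r ≤ n
    · rw [← hZ, hclock' r ⟨hr.1, le_rfl⟩ fun q hq => (hNr q ⟨hq.1, hq.2.le⟩).trans hn]
    · obtain ⟨σ, hσ, hσ1, hσ2⟩ := exists_first_gt hr.1
        (fun s hs => hrc s ⟨hs.1, hs.2.trans_lt hr.2⟩) (not_le.1 hn)
      have hS : σ ∈ Icc 0 S := ⟨hσ.1, hσ.2.trans hr.2.le⟩
      have hEq : totalCount F y X σ = totalCount F y X r :=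
        le_antisymm (hNr σ hσ) (by omega)
      have hEqj := (Finset.sum_eq_sum_iff_of_le (fun j _ =>
        hNmono j σ hS r ⟨hr.1, hr.2.le⟩ hσ.2)).1 hEq j (Finset.mem_univ j)
      rw [← hEqj, ← hclock' σ hσ hσ2 j, ← hZ]
      congr 2
      -- Past `σ` the path `Z` need not follow `X`, but its count exceeds `n` at `σ` and cannot
      -- decrease, so the killed clock stays frozen.
      have hafter : ∀ s, σ ≤ s → ¬ totalCount F y Z s ≤ n := by
        intro s hs
        rw [not_le]
        refine hσ1.trans_le ?_
        simp only [totalCount, ← hclock σ hσ hσ2 _ σ ⟨hσ.1, le_rfl⟩]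
        exact Finset.sum_le_sum fun j _ => hy j (Real.toNNReal_mono (hZmono j hs))
      have hcm : MeasurableSet {s | totalCount F y Z s ≤ n} := by
        refine measurableSet_le (Finset.measurable_sum _ fun j _ => ?_) measurable_const
        exact (hy j).measurable.comp (hZmono j).measurable.real_toNNReal
      have hki : ∀ a b, IntervalIntegrable
          (fun s => if totalCount F y Z s ≤ n then F j s (Z s) else 0) volume a b := by
        intro a b
        refine (hZi j a b).mono_fun (Measurable.ite hcm
          ((hF j).comp (measurable_id.prodMk hZm)) measurable_const).aestronglyMeasurable ?_
        refine Eventually.of_forall fun s => ?_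
        dsimp only
        split_ifs <;> simp
      rw [killedClock, killedClock, ← intervalIntegral.integral_add_adjacent_intervals
        (hki 0 σ) (hki σ r), add_eq_left]
      rw [intervalIntegral.integral_congr (g := fun _ => 0)]
      · simp
      · intro s hs
        rw [uIcc_of_le hσ.2] at hs
        exact if_neg (hafter s hs.1)

end TimeChange

/-! ### Right-continuous versions of counting paths, measurable on the product space. -/

section Regularization

open Filter Topology

/-- The right-continuous regularization of a counting path, computed from its values at rational
times. -/
noncomputable def regularize (w : ℝ≥0 → ℕ) (v : ℝ≥0) : ℕ :=
  sInf {m | ∃ q : ℚ, v < Real.toNNReal q ∧ w (Real.toNNReal q) = m}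

theorem regularize_le_iff {w : ℝ≥0 → ℕ} {v : ℝ≥0} {m : ℕ} :
    regularize w v ≤ m ↔ ∃ q : ℚ, v < Real.toNNReal q ∧ w (Real.toNNReal q) ≤ m := by
  constructor
  · intro h
    have hne : {m | ∃ q : ℚ, v < Real.toNNReal q ∧ w (Real.toNNReal q) = m}.Nonempty := by
      obtain ⟨q, -, hq, -⟩ := (NNReal.lt_iff_exists_rat_btwn v (v + 1)).1 (by simp)
      exact ⟨w (Real.toNNReal q), q, hq, rfl⟩
    obtain ⟨q, hq, hq'⟩ := Nat.sInf_mem hne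
    exact ⟨q, hq, hq'.trans_le h⟩
  · rintro ⟨q, hq, hm⟩
    exact (Nat.sInf_le (show w (Real.toNNReal q) ∈ {m | ∃ q : ℚ, v < Real.toNNReal q ∧
      w (Real.toNNReal q) = m} from ⟨q, hq, rfl⟩)).trans hm

theorem monotone_regularize (w : ℝ≥0 → ℕ) : Monotone (regularize w) := by
  intro a b hab
  obtain ⟨q, hq, hm⟩ := regularize_le_iff.1 (le_refl (regularize w b))
  exact regularize_le_iff.2 ⟨q, hab.trans_lt hq, hm⟩

theorem continuousWithinAt_regularize (w : ℝ≥0 → ℕ) (a : ℝ≥0) :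
    ContinuousWithinAt (regularize w) (Ici a) a := by
  obtain ⟨q, hq, hm⟩ := regularize_le_iff.1 (le_refl (regularize w a))
  refine tendsto_nhds_of_eventually_eq ?_
  filter_upwards [Ico_mem_nhdsGE hq] with b hb
  exact le_antisymm (regularize_le_iff.2 ⟨q, hb.2, hm⟩) (monotone_regularize w hb.1)

theorem regularize_eq {w w' : ℝ≥0 → ℕ} {v : ℝ≥0}
    (hr : ContinuousWithinAt w (Ici v) v) (h : ∀ᶠ b in 𝓝[≥] v, w' b = w b)
    (h' : ∀ b ≥ v, w v ≤ w' b) : regularize w' v = w v := by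
  have hr' : ∀ᶠ b in 𝓝[≥] v, w b = w v := by
    have := hr.tendsto
    rw [nhds_discrete] at this
    exact tendsto_pure.1 this
  apply le_antisymm
  · obtain ⟨c, hc, hc'⟩ := (mem_nhdsGE_iff_exists_Ico_subset' (show v < v + 1 by simp)).1
      (h.and hr')
    obtain ⟨q, -, hq, hq'⟩ := (NNReal.lt_iff_exists_rat_btwn v c).1 hc
    have := hc' ⟨hq.le, hq'⟩
    exact regularize_le_iff.2 ⟨q, hq, (this.1.trans this.2).le⟩
  · obtain ⟨q, hq, hm⟩ := regularize_le_iff.1 (le_refl (regularize w' v))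
    exact (h' _ hq.le).trans hm

theorem regularize_eq_self {w : ℝ≥0 → ℕ} (hw : Monotone w)
    (hr : ∀ v, ContinuousWithinAt w (Ici v) v) : regularize w = w :=
  funext fun v => regularize_eq (hr v) (Eventually.of_forall fun _ => rfl) fun _ hb => hw hb

/-- Evaluation `(v, w) ↦ w v` is not controlled by the product σ-algebra for arbitrary paths; after
regularization only countably many coordinates matter. -/
theorem measurable_regularize : Measurable fun p : ℝ≥0 × (ℝ≥0 → ℕ) => regularize p.2 p.1 := by
  refine measurable_of_Iic fun m => ?_
  have : (fun p : ℝ≥0 × (ℝ≥0 → ℕ) => regularize p.2 p.1) ⁻¹' Iic m =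
      ⋃ q : ℚ, {p | p.1 < Real.toNNReal q ∧ p.2 (Real.toNNReal q) ≤ m} := by
    ext p
    simp [regularize_le_iff]
  rw [this]
  refine MeasurableSet.iUnion fun q => ?_
  exact (measurableSet_lt measurable_fst measurable_const).inter
    (measurableSet_le ((measurable_pi_apply _).comp measurable_snd) measurable_const)

variable {ι : Type*} [DecidableEq ι]

/-- Stop the `i`-th coordinate of a family of paths at time `u`. -/
def stopCoord (i : ι) (u : ℝ≥0) (w : ι → ℝ≥0 → ℕ) : ι → ℝ≥0 → ℕ :=
  fun j v => if j = i then w j (min v u) else w j v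

theorem regularize_stopCoord {w : ι → ℝ≥0 → ℕ} (hw : ∀ j, Monotone (w j))
    (hr : ∀ j v, ContinuousWithinAt (w j) (Ici v) v) {i j : ι} {u v : ℝ≥0} (h : j = i → v < u) :
    regularize (stopCoord i u w j) v = w j v := by
  by_cases hj : j = i
  · refine regularize_eq (hr j v) ?_ fun b hb => ?_
    · filter_upwards [Ico_mem_nhdsGE (h hj)] with b hb
      simp [stopCoord, hj, min_eq_left hb.2.le]
    · simpa [stopCoord, hj] using hw i (le_min hb (h hj).le)
  · have : stopCoord i u w j = w j := by
      ext b
      simp [stopCoord, hj]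
    rw [this, regularize_eq_self (hw j) (hr j)]

end Regularization

/-! ### Internal clocks as measurable functionals of the driving paths. -/

section Truncation

open Filter Topology

variable {ι E : Type*}

/-- The rates `f`, extended constantly in time outside `[0, T]` and truncated to `[0, M]`. -/
noncomputable def truncRate (f : ι → ℝ → E → ℝ) (T : ℝ) (M : ℕ) (j : ι) (s : ℝ) (x : E) : ℝ :=
  min (max (f j (max 0 (min s T)) x) 0) M

theorem truncRate_nonneg (f : ι → ℝ → E → ℝ) (T : ℝ) (M : ℕ) (j : ι) (s : ℝ) (x : E) :
    0 ≤ truncRate f T M j s x :=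
  le_min (le_max_right _ _) (Nat.cast_nonneg M)

theorem truncRate_le (f : ι → ℝ → E → ℝ) (T : ℝ) (M : ℕ) (j : ι) (s : ℝ) (x : E) :
    truncRate f T M j s x ≤ M :=
  min_le_right _ _

theorem truncRate_eq {f : ι → ℝ → E → ℝ} {T : ℝ} {M : ℕ} {j : ι} {s : ℝ} {x : E}
    (hs : s ∈ Icc 0 T) (h0 : 0 ≤ f j s x) (hM : f j s x ≤ M) : truncRate f T M j s x = f j s x := by
  rw [truncRate, min_eq_left hs.2, max_eq_right hs.1, max_eq_left h0, min_eq_left hM]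

variable [NormedAddCommGroup E] [MeasurableSpace E] [BorelSpace E] [SecondCountableTopology E]

theorem measurable_truncRate {f : ι → ℝ → E → ℝ} {T : ℝ} (hT : 0 ≤ T) {j : ι}
    (hf : ContinuousOn (fun p : ℝ × E => f j p.1 p.2) (Icc 0 T ×ˢ univ)) (M : ℕ) :
    Measurable (Function.uncurry (truncRate f T M j)) := by
  have : Continuous fun p : ℝ × E => f j (max 0 (min p.1 T)) p.2 :=
    hf.comp_continuous (f := fun p : ℝ × E => (max 0 (min p.1 T), p.2)) (by fun_prop)
      fun p => ⟨⟨le_max_left _ _, max_le hT (min_le_right _ _)⟩, trivial⟩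
  exact ((this.max continuous_const).min continuous_const).measurable

variable [Fintype ι] [NormedSpace ℝ E]

/-- The counts on `[0, S)` are bounded by those at clock value `S`, so the path is bounded there,
and by linear growth so are its rates. A large `n` exceeds both the number of events and the rates,
so neither killing nor truncation is felt. The equation is needed only before `S`, yet the clocks at
`S` are recovered. -/
theorem exists_approxSolution_eq {f : ι → ℝ → E → ℝ} {T : ℝ} {C : ι → ℝ} {v : ι → E} {x₀ : E}
    {y : ι → ℝ≥0 → ℕ} {X : ℝ → E} {S : ℝ}
    (hf : ∀ j, ContinuousOn (fun p : ℝ × E => f j p.1 p.2) (Icc 0 T ×ˢ univ))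
    (hC : ∀ j, ∀ t ∈ Icc 0 T, ∀ x, |f j t x| ≤ C j * (1 + ‖x‖))
    (hy : ∀ j, Monotone (y j)) (hyr : ∀ j a, ContinuousWithinAt (y j) (Ici a) a)
    (hS : S ∈ Icc 0 T) (h0 : ∀ j, ∀ t ∈ Icc 0 T, 0 ≤ f j t (X t))
    (hi : ∀ j, IntegrableOn (fun s => f j s (X s)) (Icc 0 T))
    (hX : ∀ r ∈ Ico 0 S, X r = x₀ + ∑ j, (y j (internalClock f X j r).toNNReal : ℝ) • v j) :
    ∃ n₀, ∀ n ≥ n₀,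
      (∀ r ∈ Ico 0 S, approxSolution (truncRate f T n) v x₀ y n r = X r) ∧
      ∀ j, internalClock (truncRate f T n) (approxSolution (truncRate f T n) v x₀ y n) j S =
        internalClock f X j S := by
  have hii : ∀ j, IntervalIntegrable (fun s => f j s (X s)) volume 0 S := fun j =>
    (intervalIntegrable_iff_integrableOn_Icc_of_le hS.1).2
      ((hi j).mono_set (Icc_subset_Icc_right hS.2))
  have hmono := fun j => internalClock_monoOn (hii j) fun s hs =>
    h0 j s ⟨hs.1, hs.2.trans hS.2⟩
  set K : ℕ := ∑ j, y j (internalClock f X j S).toNNReal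
  have hyS : ∀ j, ∀ r ∈ Ico 0 S, y j (internalClock f X j r).toNNReal ≤
      y j (internalClock f X j S).toNNReal := fun j r hr =>
    hy j (Real.toNNReal_mono (hmono j ⟨hr.1, hr.2.le⟩ ⟨hS.1, le_rfl⟩ hr.2.le))
  set B : ℝ := ‖x₀‖ + ∑ j, (y j (internalClock f X j S).toNNReal : ℝ) * ‖v j‖
  have hB : ∀ r ∈ Ico 0 S, ‖X r‖ ≤ B := by
    intro r hr
    rw [hX r hr]
    refine (norm_add_le _ _).trans (add_le_add_right ((norm_sum_le _ _).trans
      (Finset.sum_le_sum fun j _ => ?_)) _)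
    rw [norm_smul, Real.norm_natCast]
    gcongr
    exact hyS j r hr
  have hB0 : 0 ≤ B := by positivity
  set M : ℝ := ∑ j, |C j| * (1 + B)
  have hM : ∀ r ∈ Ico 0 S, ∀ j, f j r (X r) ≤ M := by
    intro r hr j
    calc f j r (X r) ≤ C j * (1 + ‖X r‖) :=
          (le_abs_self _).trans (hC j r ⟨hr.1, hr.2.le.trans hS.2⟩ _)
      _ ≤ |C j| * (1 + B) := by
          gcongr
          · exact le_abs_self _
          · exact hB r hr
      _ ≤ M := Finset.single_le_sum (f := fun j => |C j| * (1 + B))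
          (fun j _ => by positivity) (Finset.mem_univ j)
  refine ⟨max K ⌈M⌉₊, fun n hn => ?_⟩
  have hrate : ∀ r ∈ Ico 0 S, ∀ j, truncRate f T n j r (X r) = f j r (X r) := fun r hr j =>
    truncRate_eq ⟨hr.1, hr.2.le.trans hS.2⟩ (h0 j r ⟨hr.1, hr.2.le.trans hS.2⟩)
      ((hM r hr j).trans ((Nat.le_ceil M).trans (by exact_mod_cast (le_max_right _ _).trans hn)))
  have hae : ∀ r ∈ Icc 0 S, ∀ᵐ s ∂(volume : Measure ℝ), s ∈ uIoc 0 r → s ∈ Ico 0 S := by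
    intro r hr
    have hne : ∀ᵐ s ∂(volume : Measure ℝ), s ≠ S := by simp [ae_iff]
    filter_upwards [hne] with s hs hs'
    rw [uIoc_of_le hr.1] at hs'
    exact ⟨hs'.1.le, lt_of_le_of_ne (hs'.2.trans hr.2) hs⟩
  have hclock : ∀ r ∈ Icc 0 S, ∀ j,
      internalClock (truncRate f T n) X j r = internalClock f X j r := fun r hr j =>
    intervalIntegral.integral_congr_ae ((hae r hr).mono fun s hs hs' => hrate s (hs hs') j)
  have hiF : ∀ j, IntervalIntegrable (fun s => truncRate f T n j s (X s)) volume 0 S := fun j =>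
    (hii j).congr_ae (by
      rw [Filter.EventuallyEq, ae_restrict_iff' measurableSet_uIoc]
      exact (hae S ⟨hS.1, le_rfl⟩).mono fun s hs hs' => (hrate s (hs hs') j).symm)
  have hmain : ∀ r ∈ Ico 0 S, approxSolution (truncRate f T n) v x₀ y n r = X r := by
    intro r hr
    refine approxSolution_eq_of_totalCount_le (fun j => measurable_truncRate
      (hS.1.trans hS.2) (hf j) n) (truncRate_nonneg f T n) (truncRate_le f T n) hy hyr hiF
      (fun r hr => ?_) n r hr ?_
    · simp only [hclock r ⟨hr.1, hr.2.le⟩]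
      exact hX r hr
    · simp only [totalCount, hclock r ⟨hr.1, hr.2.le⟩]
      exact (Finset.sum_le_sum fun j _ => hyS j r hr).trans ((le_max_left _ _).trans hn)
  refine ⟨hmain, fun j => ?_⟩
  rw [← hclock S ⟨hS.1, le_rfl⟩]
  refine intervalIntegral.integral_congr_ae ((hae S ⟨hS.1, le_rfl⟩).mono fun s hs hs' => ?_)
  rw [hmain s (hs hs')]

/-- The internal clock of channel `i` at time `t`, as a functional of the driving paths `w`, up to
the `n`-th step of the construction. -/
noncomputable def approxClock (f : ι → ℝ → E → ℝ) (T : ℝ) (v : ι → E) (x₀ : E) (n : ℕ) (i : ι)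
    (t : ℝ) (w : ι → ℝ≥0 → ℕ) : ℝ :=
  internalClock (truncRate f T n)
    (approxSolution (truncRate f T n) v x₀ (fun j => regularize (w j)) n) i t

theorem measurable_regularized_approxSolution {f : ι → ℝ → E → ℝ} {T : ℝ} (hT : 0 ≤ T)
    (hf : ∀ j, ContinuousOn (fun p : ℝ × E => f j p.1 p.2) (Icc 0 T ×ˢ univ))
    (v : ι → E) (x₀ : E) (n : ℕ) :
    Measurable fun p : ℝ × (ι → ℝ≥0 → ℕ) =>
      approxSolution (truncRate f T n) v x₀ (fun j => regularize (p.2 j)) n p.1 :=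
  measurable_approxSolution (fun j => measurable_truncRate hT (hf j) n) v x₀
    (y := fun (w : ι → ℝ≥0 → ℕ) j => regularize (w j)) (fun j => measurable_regularize.comp
      (measurable_fst.prodMk ((measurable_pi_apply j).comp measurable_snd))) n

theorem measurable_approxClock {f : ι → ℝ → E → ℝ} {T : ℝ} (hT : 0 ≤ T)
    (hf : ∀ j, ContinuousOn (fun p : ℝ × E => f j p.1 p.2) (Icc 0 T ×ˢ univ))
    (v : ι → E) (x₀ : E) (n : ℕ) (i : ι) (t : ℝ) : Measurable (approxClock f T v x₀ n i t) :=
  (measurable_internalClock (fun j => measurable_truncRate hT (hf j) n)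
    (measurable_regularized_approxSolution hT hf v x₀ n) i).comp
    (measurable_const.prodMk measurable_id)

/-- The stopping-time property: the right-hand side sees channel `i` only up to `u`. While clock `i`
is below `u`, the stopped and the original driving paths produce the same solution. -/
theorem le_internalClock_iff [DecidableEq ι] {f : ι → ℝ → E → ℝ} {T : ℝ} {C : ι → ℝ} {v : ι → E}
    {x₀ : E} {w : ι → ℝ≥0 → ℕ} {X : ℝ → E}
    (hf : ∀ j, ContinuousOn (fun p : ℝ × E => f j p.1 p.2) (Icc 0 T ×ˢ univ))
    (hC : ∀ j, ∀ t ∈ Icc 0 T, ∀ x, |f j t x| ≤ C j * (1 + ‖x‖))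
    (hw : ∀ j, Monotone (w j)) (hwr : ∀ j a, ContinuousWithinAt (w j) (Ici a) a)
    (h0 : ∀ j, ∀ t ∈ Icc 0 T, 0 ≤ f j t (X t))
    (hi : ∀ j, IntegrableOn (fun s => f j s (X s)) (Icc 0 T))
    (hX : ∀ r ∈ Icc 0 T, X r = x₀ + ∑ j, (w j (internalClock f X j r).toNNReal : ℝ) • v j)
    (i : ι) (u : ℝ≥0) {t : ℝ} (ht : t ∈ Icc 0 T) :
    u ≤ (internalClock f X i t).toNNReal ↔
      ∀ᶠ n in atTop, u ≤ (approxClock f T v x₀ n i t (stopCoord i u w)).toNNReal := by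
  have hit : IntervalIntegrable (fun s => f i s (X s)) volume 0 t :=
    (intervalIntegrable_iff_integrableOn_Icc_of_le ht.1).2
      ((hi i).mono_set (Icc_subset_Icc_right ht.2))
  have hmono := internalClock_monoOn hit fun s hs => h0 i s ⟨hs.1, hs.2.trans ht.2⟩
  have key : ∀ S ∈ Icc 0 t, (∀ r ∈ Ico 0 S, (internalClock f X i r).toNNReal < u) →
      ∀ᶠ n in atTop, approxClock f T v x₀ n i S (stopCoord i u w) = internalClock f X i S := by
    intro S hS hr
    obtain ⟨n₀, hn₀⟩ := exists_approxSolution_eq (y := fun j => regularize (stopCoord i u w j))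
      hf hC (fun j => monotone_regularize _) (fun j a => continuousWithinAt_regularize _ a)
      (S := S) ⟨hS.1, hS.2.trans ht.2⟩ h0 hi (v := v) (x₀ := x₀) (fun r hrS => by
        rw [hX r ⟨hrS.1, hrS.2.le.trans (hS.2.trans ht.2)⟩]
        congr 1
        refine Finset.sum_congr rfl fun j _ => ?_
        rw [regularize_stopCoord hw hwr]
        rintro rfl
        exact hr r hrS)
    filter_upwards [eventually_ge_atTop n₀] with n hn
    exact (hn₀ n hn).2 i
  by_cases hu : u ≤ (internalClock f X i t).toNNReal
  · refine iff_of_true hu ?_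
    -- At the first time `sInf A` at which the clock reaches `u`, the reconstructed clock is still
    -- exact. Afterwards it may be wrong, but it is nondecreasing and stays at least `u`.
    set A : Set ℝ := {s | s ∈ Icc 0 t ∧ u ≤ (internalClock f X i s).toNNReal} with hA
    have hcl : IsClosed A := by
      have := (continuous_real_toNNReal.comp_continuousOn
        (internalClock_continuousOn ht.1 hit)).preimage_isClosed_of_isClosed isClosed_Icc
        (isClosed_Ici (a := u))
      exact this
    have hAb : BddBelow A := ⟨0, fun s hs => hs.1.1⟩
    have hS : sInf A ∈ A := hcl.csInf_mem ⟨t, ⟨ht.1, le_rfl⟩, hu⟩ hAb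
    filter_upwards [key (sInf A) hS.1 fun r hr => by
      by_contra! hc
      exact absurd (csInf_le hAb ⟨⟨hr.1, hr.2.le.trans hS.1.2⟩, hc⟩) (not_le.2 hr.2)] with n hn
    refine hS.2.trans (Real.toNNReal_mono ?_)
    rw [← hn]
    exact internalClock_mono (measurable_truncRate (ht.1.trans ht.2) (hf i) n)
      (truncRate_nonneg f T n i) (truncRate_le f T n i) (measurable_approxSolution_path
        (fun j => measurable_truncRate (ht.1.trans ht.2) (hf j) n) v x₀
        (fun j => monotone_regularize _) n) hS.1.2
  · refine iff_of_false hu fun hc => ?_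
    obtain ⟨n, hn, hn'⟩ := (hc.and (key t ⟨ht.1, le_rfl⟩ fun r hr =>
      (Real.toNNReal_mono (hmono ⟨hr.1, hr.2.le⟩ ⟨ht.1, le_rfl⟩ hr.2.le)).trans_lt
        (not_le.1 hu))).exists
    exact hu (hn' ▸ hn)

/-- Exhibits `X` as a limit of jointly measurable functions of time and driving paths. -/
theorem eventually_approxSolution_eq {f : ι → ℝ → E → ℝ} {T : ℝ} {C : ι → ℝ} {v : ι → E}
    {x₀ : E} {w : ι → ℝ≥0 → ℕ} {X : ℝ → E}
    (hf : ∀ j, ContinuousOn (fun p : ℝ × E => f j p.1 p.2) (Icc 0 T ×ˢ univ))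
    (hC : ∀ j, ∀ t ∈ Icc 0 T, ∀ x, |f j t x| ≤ C j * (1 + ‖x‖))
    (hw : ∀ j, Monotone (w j)) (hwr : ∀ j a, ContinuousWithinAt (w j) (Ici a) a)
    (h0 : ∀ j, ∀ t ∈ Icc 0 T, 0 ≤ f j t (X t))
    (hi : ∀ j, IntegrableOn (fun s => f j s (X s)) (Icc 0 T))
    (hX : ∀ r ∈ Icc 0 T, X r = x₀ + ∑ j, (w j (internalClock f X j r).toNNReal : ℝ) • v j)
    {t : ℝ} (ht : t ∈ Icc 0 T) :
    ∀ᶠ n in atTop, ∀ r ∈ Ico 0 t,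
      approxSolution (truncRate f T n) v x₀ (fun j => regularize (w j)) n r = X r := by
  have hreg : (fun j => regularize (w j)) = w := funext fun j => regularize_eq_self (hw j) (hwr j)
  obtain ⟨n₀, hn₀⟩ := exists_approxSolution_eq hf hC hw hwr ht h0 hi
    (fun r hr => hX r ⟨hr.1, hr.2.le.trans ht.2⟩)
  filter_upwards [eventually_ge_atTop n₀] with n hn
  simpa only [hreg] using (hn₀ n hn).1

end Truncation

/-! ### Poisson processes: moments, independence and optional stopping. -/

section Poisson

open Filter Topology
open scoped ENNReal

theorem lintegral_poissonMeasure {r : ℝ≥0} {g : ℕ → ℝ} {a : ℝ} (hg : ∀ n, 0 ≤ g n)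
    (h : HasSum (fun n => Real.exp (-r) * r ^ n / n.factorial * g n) a) :
    ∫⁻ n, ENNReal.ofReal (g n) ∂(poissonMeasure r) = ENNReal.ofReal a := by
  rw [poissonMeasure, lintegral_sum_measure, ← h.tsum_eq,
    ENNReal.ofReal_tsum_of_nonneg (fun n => mul_nonneg (by positivity) (hg n)) h.summable]
  refine tsum_congr fun n => ?_
  rw [lintegral_smul_measure, lintegral_dirac, smul_eq_mul, ENNReal.ofReal_mul (by positivity)]

theorem lintegral_id_poissonMeasure (r : ℝ≥0) : ∫⁻ n, (n : ℝ≥0∞) ∂(poissonMeasure r) = r := by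
  have h := lintegral_poissonMeasure (r := r) (g := fun n => (n : ℝ)) (a := r)
    (fun n => Nat.cast_nonneg n) ?_
  · simpa using h
  · rw [← hasSum_nat_add_iff' 1]
    have := (hasSum_one_poissonMeasure r).mul_left (r : ℝ)
    simp only [Finset.range_one, Finset.sum_singleton, Nat.cast_zero, mul_zero, sub_zero, mul_one]
      at this ⊢
    refine this.congr_fun fun n => ?_
    rw [Nat.factorial_succ]
    push_cast
    field_simp
    ring

theorem lintegral_exp_poissonMeasure (r : ℝ≥0) :
    ∫⁻ n, ENNReal.ofReal (Real.exp n) ∂(poissonMeasure r) =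
      ENNReal.ofReal (Real.exp (r * (Real.exp 1 - 1))) := by
  refine lintegral_poissonMeasure (fun n => (Real.exp_pos _).le) ?_
  have h := (NormedSpace.expSeries_div_hasSum_exp ((r : ℝ) * Real.exp 1)).mul_left (Real.exp (-r))
  rw [← Real.exp_eq_exp_ℝ, ← Real.exp_add] at h
  rw [show (r : ℝ) * (Real.exp 1 - 1) = -r + r * Real.exp 1 by ring]
  refine h.congr_fun fun n => ?_
  rw [mul_pow, ← Real.exp_nat_mul, mul_one]
  ring

variable {Ω : Type*} [MeasurableSpace Ω] {P : Measure Ω} {Y : ℝ≥0 → Ω → ℕ}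

theorem IsPoissonProcess.lintegral_increment {r : ℝ≥0} (hY : IsPoissonProcess Y r P) (u h : ℝ≥0) :
    ∫⁻ ω, ((Y (u + h) ω - Y u ω : ℕ) : ℝ≥0∞) ∂P = r * h := by
  have hl := hY.law u (u + h) (by simp)
  have := hl.lintegral_comp (f := fun n : ℕ => (n : ℝ≥0∞)) (by fun_prop)
  rw [this, lintegral_id_poissonMeasure]
  simp

/-- For `m = ⌊v⌋₊`, `Y v ≤ Y (m + 1) ≤ 2 * m + exp (Y (m + 1) - 2 * m)`, and `W` is the sum of these
exponentials over `m`. Their expectations form a geometric series of ratio `exp (e - 3) < 1`; the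
slope `2` works because it exceeds `e - 1`. -/
theorem IsPoissonProcess.exists_linear_bound (hY : IsPoissonProcess Y 1 P) :
    ∃ W : Ω → ℝ, Integrable W P ∧ (∀ ω, 0 ≤ W ω) ∧ ∀ᵐ ω ∂P, ∀ v, (Y v ω : ℝ) ≤ 2 * v + W ω := by
  set V : Ω → ℝ≥0∞ := fun ω => ∑' m : ℕ, ENNReal.ofReal (Real.exp (Y (m + 1) ω - 2 * m))
  have hmeas : ∀ m : ℕ, Measurable fun ω => ENNReal.ofReal (Real.exp (Y (m + 1) ω - 2 * m)) := by
    intro m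
    have := hY.measurable (m + 1)
    have h2 : Measurable fun ω => (Y (m + 1) ω : ℝ) :=
      (measurable_from_top (f := fun m : ℕ => (m : ℝ))).comp this
    fun_prop
  have hV : Measurable V := Measurable.tsum hmeas
  have hint : ∫⁻ ω, V ω ∂P ≠ ∞ := by
    have hterm : ∀ m : ℕ, ∫⁻ ω, ENNReal.ofReal (Real.exp (Y (m + 1) ω - 2 * m)) ∂P =
        ENNReal.ofReal (Real.exp (Real.exp 1 - 1)) *
          ENNReal.ofReal (Real.exp (Real.exp 1 - 3)) ^ m := by
      intro m
      have h1 : (fun ω => ENNReal.ofReal (Real.exp (Y (m + 1) ω - 2 * m))) =ᵐ[P] fun ω =>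
          ENNReal.ofReal (Real.exp (-(2 * m))) *
            ENNReal.ofReal (Real.exp ((Y (m + 1) ω - Y 0 ω : ℕ) : ℝ)) := by
        filter_upwards [hY.zero] with ω hω
        rw [hω, ← ENNReal.ofReal_mul (Real.exp_pos _).le, ← Real.exp_add]
        simp only [tsub_zero]
        ring_nf
      have h2 := (hY.law 0 (m + 1) (by simp)).lintegral_comp
        (f := fun n : ℕ => ENNReal.ofReal (Real.exp n)) (by fun_prop)
      rw [lintegral_congr_ae h1, lintegral_const_mul' _ _ ENNReal.ofReal_ne_top, h2,
        lintegral_exp_poissonMeasure, ← ENNReal.ofReal_mul (Real.exp_pos _).le, ← Real.exp_add,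
        ← ENNReal.ofReal_pow (Real.exp_pos _).le, ← Real.exp_nat_mul,
        ← ENNReal.ofReal_mul (Real.exp_pos _).le, ← Real.exp_add]
      push_cast
      congr 2
      simp
      ring
    rw [lintegral_tsum fun m => (hmeas m).aemeasurable]
    simp_rw [hterm]
    rw [ENNReal.tsum_mul_left, ENNReal.tsum_geometric]
    refine ENNReal.mul_ne_top ENNReal.ofReal_ne_top (ENNReal.inv_ne_top.2 ?_)
    rw [Ne, tsub_eq_zero_iff_le, not_le, ENNReal.ofReal_lt_one, Real.exp_lt_one_iff]
    linarith [Real.exp_one_lt_d9]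
  refine ⟨fun ω => (V ω).toReal, integrable_toReal_of_lintegral_ne_top hV.aemeasurable hint,
    fun ω => ENNReal.toReal_nonneg, ?_⟩
  filter_upwards [hY.monotone, ae_lt_top hV hint] with ω hmono hfin v
  set m := ⌊v⌋₊
  have hm : (m : ℝ) ≤ v := by exact_mod_cast Nat.floor_le v.2
  have hYv : Y v ω ≤ Y (m + 1) ω := hmono (Nat.lt_floor_add_one v).le
  have hle : Real.exp (Y (m + 1) ω - 2 * m) ≤ (V ω).toReal := by
    rw [← ENNReal.ofReal_le_iff_le_toReal hfin.ne]
    exact ENNReal.le_tsum (f := fun m : ℕ => ENNReal.ofReal (Real.exp (Y (m + 1) ω - 2 * m))) m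
  have h3 := Real.add_one_le_exp ((Y (m + 1) ω : ℝ) - 2 * m)
  have h4 : (Y v ω : ℝ) ≤ Y (m + 1) ω := by exact_mod_cast hYv
  linarith

theorem IsPoissonProcess.indepFun_stopped [IsProbabilityMeasure P] {r : ℝ≥0}
    (hY : IsPoissonProcess Y r P) (u h : ℝ≥0) :
    IndepFun (fun ω v => Y (min v u) ω) (fun ω => Y (u + h) ω - Y u ω) P := by
  refine IndepFun.process_indepFun (fun v => hY.measurable _)
    ((hY.measurable _).sub (hY.measurable _)) fun I => ?_
  set J : Finset ℝ≥0 := insert 0 (insert u (I.image (min · u))) with hJ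
  have hJu : ∀ a ∈ J, a ≤ u := by
    intro a ha
    simp only [hJ, Finset.mem_insert, Finset.mem_image] at ha
    rcases ha with rfl | rfl | ⟨b, -, rfl⟩
    · exact zero_le
    · exact le_rfl
    · exact min_le_right _ _
  have hpos : 0 < J.card := Finset.card_pos.2 ⟨0, by simp [hJ]⟩
  set e := J.orderEmbOfFin rfl
  have he : ∀ a ∈ J, ∃ m, e m = a := fun a ha => by
    have : a ∈ Set.range e := by
      rw [Finset.range_orderEmbOfFin]
      exact ha
    exact this
  -- The points of `J` in increasing order, then `u + h`. As `u` is the largest point of `J`,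
  -- increment number `J.card - 1` is the one from `u` to `u + h`; as `0 ∈ J`, the stopped values
  -- are sums of earlier increments.
  set t : ℕ → ℝ≥0 := fun m => if hm : m < J.card then e ⟨m, hm⟩ else u + h with ht
  have htm : Monotone t := by
    intro a b hab
    by_cases hb : b < J.card
    · simp only [ht, hb, hab.trans_lt hb, dif_pos]
      exact e.monotone hab
    · by_cases ha : a < J.card
      · simp only [ht, hb, ha, dif_pos, dif_neg, not_false_iff]
        exact (hJu _ (J.orderEmbOfFin_mem rfl _)).trans (by simp)
      · simp [ht, ha, hb]
  have htJ : ∀ a ∈ J, ∃ m < J.card, t m = a := fun a ha => by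
    obtain ⟨m, hm⟩ := he a ha
    exact ⟨m, m.2, by simp [ht, hm]⟩
  have ht0 : t 0 = 0 := by
    obtain ⟨m, -, hm⟩ := htJ 0 (by simp [hJ])
    exact le_antisymm (hm ▸ htm (Nat.zero_le m)) zero_le
  have htu : t (J.card - 1) = u := by
    obtain ⟨m, hm', hm⟩ := htJ u (by simp [hJ])
    refine le_antisymm ?_ (hm ▸ htm (by omega))
    have : J.card - 1 < J.card := by omega
    simp only [ht, this, dif_pos]
    exact hJu _ (J.orderEmbOfFin_mem rfl _)
  have htl : t (J.card - 1 + 1) = u + h := by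
    simp only [ht]
    rw [dif_neg (by omega)]
  choose! m hmlt hm using fun (v : ℝ≥0) (hv : v ∈ I) => htJ (min v u)
    (by simp only [hJ, Finset.mem_insert, Finset.mem_image]; exact Or.inr (Or.inr ⟨v, hv, rfl⟩))
  have hind := (hY.indep.nat htm).indepFun_finset (Finset.range (J.card - 1)) {J.card - 1}
    (by simp) (fun i => (hY.measurable _).sub (hY.measurable _))
  let G : (Finset.range (J.card - 1) → ℕ) → I → ℕ := fun x v =>
    ∑ a : Finset.range (J.card - 1), if (a : ℕ) < m v then x a else 0
  have hG : Measurable G := by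
    refine measurable_pi_lambda _ fun v => Finset.measurable_sum _ fun a _ => ?_
    split_ifs
    · exact measurable_pi_apply a
    · exact measurable_const
  have hlast : Measurable fun x : ({J.card - 1} : Finset ℕ) → ℕ => x ⟨J.card - 1, by simp⟩ :=
    measurable_pi_apply _
  have hcomp := hind.comp hG hlast
  refine hcomp.congr ?_ (Eventually.of_forall fun ω => ?_)
  · filter_upwards [hY.zero, hY.monotone] with ω h0 hmono
    ext v
    simp only [Function.comp, G]
    have hle : m v ≤ J.card - 1 := by have := hmlt v v.2; omega
    rw [Finset.sum_coe_sort (Finset.range (J.card - 1))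
      (fun a => if a < m v then Y (t (a + 1)) ω - Y (t a) ω else 0), ← Finset.sum_filter]
    have : (Finset.range (J.card - 1)).filter (· < m v) = Finset.range (m v) := by
      ext a
      simp only [Finset.mem_filter, Finset.mem_range]
      omega
    rw [this, Finset.sum_range_tsub (f := fun a => Y (t a) ω)
      (fun a b hab => hmono (htm hab)), ht0, h0, hm v v.2, tsub_zero]
  · simp only [Function.comp, htu, htl]

/-- The joint law is the product of the three marginals, and the factors may be reordered. -/
theorem IndepFun.prodMk_of_prodMk {α β γ : Type*} [MeasurableSpace α] [MeasurableSpace β]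
    [MeasurableSpace γ] [IsProbabilityMeasure P] {A : Ω → α} {D : Ω → β} {B : Ω → γ}
    (hA : Measurable A) (hD : Measurable D) (hB : Measurable B) (hAD : IndepFun A D P)
    (hADB : IndepFun (fun ω => (A ω, D ω)) B P) : IndepFun (fun ω => (A ω, B ω)) D P := by
  have hAB : IndepFun A B P := hADB.comp (φ := Prod.fst) (ψ := id) measurable_fst measurable_id
  have := Measure.isProbabilityMeasure_map (μ := P) hA.aemeasurable
  have := Measure.isProbabilityMeasure_map (μ := P) hB.aemeasurable
  have := Measure.isProbabilityMeasure_map (μ := P) hD.aemeasurable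
  rw [indepFun_iff_map_prod_eq_prod_map_map (by fun_prop) (by fun_prop)] at hAD hADB hAB ⊢
  rw [hAD] at hADB
  rw [hAB]
  have h1 := measurePreserving_prodAssoc (P.map A) (P.map D) (P.map B)
  have h2 := (MeasurePreserving.id (P.map A)).prod
    (Measure.measurePreserving_swap (μ := P.map D) (ν := P.map B))
  have h3 := (measurePreserving_prodAssoc (P.map A) (P.map B) (P.map D)).symm
    MeasurableEquiv.prodAssoc
  have h4 := (h3.comp (h2.comp h1)).map_eq
  rw [← hADB, Measure.map_map (by fun_prop) (by fun_prop)] at h4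
  exact h4

theorem indepFun_stopCoord_increment [IsProbabilityMeasure P] {ι : Type*} [Fintype ι]
    [DecidableEq ι] {Y : ι → ℝ≥0 → Ω → ℕ} {r : ℝ≥0} (hY : ∀ i, IsPoissonProcess (Y i) r P)
    (hind : iIndepFun (fun i ω t => Y i t ω) P) (i : ι) (u h : ℝ≥0) :
    IndepFun (fun ω => stopCoord i u fun j v => Y j v ω)
      (fun ω => Y i (u + h) ω - Y i u ω) P := by
  have hm : ∀ j, Measurable fun ω t => Y j t ω := fun j =>
    measurable_pi_lambda _ fun t => (hY j).measurable t
  have h1 := hind.indepFun_finset {i} (Finset.univ.erase i) (by simp) hm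
  have h2 : IndepFun (fun ω => ((fun v => Y i (min v u) ω), Y i (u + h) ω - Y i u ω))
      (fun ω (j : Finset.univ.erase i) v => Y j v ω) P :=
    h1.comp (φ := fun x : (({i} : Finset ι) → ℝ≥0 → ℕ) =>
      ((fun v : ℝ≥0 => x ⟨i, by simp⟩ (min v u)), x ⟨i, by simp⟩ (u + h) - x ⟨i, by simp⟩ u))
      (ψ := id) (by fun_prop) measurable_id
  have h3 := IndepFun.prodMk_of_prodMk (D := fun ω => Y i (u + h) ω - Y i u ω)
    (B := fun ω (j : Finset.univ.erase i) v => Y j v ω)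
    (measurable_pi_lambda _ fun v => (hY i).measurable _)
    (((hY i).measurable _).sub ((hY i).measurable _)) (measurable_pi_lambda _ fun j => hm j.1)
    ((hY i).indepFun_stopped u h) h2
  have h4 := h3.comp (φ := fun x : (ℝ≥0 → ℕ) × (Finset.univ.erase i → ℝ≥0 → ℕ) =>
    fun j v => if hj : j = i then x.1 v else x.2 ⟨j, by simp [hj]⟩ v) (ψ := id) (by
      refine measurable_pi_lambda _ fun j => measurable_pi_lambda _ fun v => ?_
      split_ifs <;> fun_prop) measurable_id
  refine h4.congr (Eventually.of_forall fun ω => ?_) Filter.EventuallyEq.rfl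
  ext j v
  by_cases hj : j = i
  · subst hj
    simp [stopCoord]
  · simp [stopCoord, hj]

/-- With `τ` rounded up to `σ n` on a grid of mesh `δ n`, `Y (σ n)` is the sum of the grid
increments starting at points `m * δ n ≤ τ`. Independence factors each term, and the sum is `E[σ
n]`. The limit uses right-continuity, which is why rounding goes up, and domination by the linear
bound. -/
theorem IsPoissonProcess.lintegral_comp_eq [IsProbabilityMeasure P] (hY : IsPoissonProcess Y 1 P)
    {τ : Ω → ℝ≥0} (hτ : AEMeasurable τ P)
    (hind : ∀ u h, IndepFun (fun ω => Y (u + h) ω - Y u ω)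
      ({ω | u ≤ τ ω}.indicator (1 : Ω → ℝ≥0∞)) P)
    (hfin : ∫⁻ ω, τ ω ∂P ≠ ∞) : ∫⁻ ω, (Y (τ ω) ω : ℝ≥0∞) ∂P = ∫⁻ ω, τ ω ∂P := by
  set δ : ℕ → ℝ≥0 := fun n => 1 / ((n : ℝ≥0) + 1) with hδ
  have hδ0 : ∀ n, 0 < δ n := fun n => by positivity
  have hδ1 : ∀ n, δ n ≤ 1 := fun n => by
    rw [hδ]
    exact div_le_one_of_le₀ (by simp) (by positivity)
  have hδt : Tendsto δ atTop (𝓝 0) := tendsto_one_div_add_atTop_nhds_zero_nat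
  set σ : ℕ → Ω → ℝ≥0 := fun n ω => (⌊τ ω / δ n⌋₊ + 1) * δ n with hσ
  have hσ1 : ∀ n ω, τ ω ≤ σ n ω := fun n ω => by
    have := (Nat.lt_floor_add_one (τ ω / δ n)).le
    rwa [div_le_iff₀ (hδ0 n)] at this
  have hσ2 : ∀ n ω, σ n ω ≤ τ ω + δ n := fun n ω => by
    have := Nat.floor_le (zero_le (a := τ ω / δ n))
    rw [le_div_iff₀ (hδ0 n)] at this
    simp only [hσ, add_mul, one_mul]
    gcongr
  set J : ℕ → ℕ → Ω → ℝ≥0∞ := fun n m =>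
    {ω | (m * δ n : ℝ≥0) ≤ τ ω}.indicator (1 : Ω → ℝ≥0∞) with hJ
  have hJm : ∀ n m, AEMeasurable (J n m) P := fun n m =>
    (aemeasurable_const (b := (1 : ℝ≥0∞))).indicator₀
      (nullMeasurableSet_le aemeasurable_const hτ)
  have hsum : ∀ n ω (g : ℕ → ℝ≥0∞), ∑' m, g m * J n m ω =
      ∑ m ∈ Finset.range (⌊τ ω / δ n⌋₊ + 1), g m := by
    intro n ω g
    have hmem : ∀ m : ℕ, (m * δ n : ℝ≥0) ≤ τ ω ↔ m ∈ Finset.range (⌊τ ω / δ n⌋₊ + 1) := by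
      intro m
      rw [Finset.mem_range, Nat.lt_succ_iff, Nat.le_floor_iff zero_le, le_div_iff₀ (hδ0 n)]
    rw [tsum_eq_sum (s := Finset.range (⌊τ ω / δ n⌋₊ + 1))]
    · refine Finset.sum_congr rfl fun m hm => ?_
      simp [hJ, (hmem m).2 hm]
    · intro m hm
      simp only [hJ]
      rw [indicator_of_notMem (by simpa using fun h => hm ((hmem m).1 h)), mul_zero]
  have hYσ : ∀ n, (fun ω => (Y (σ n ω) ω : ℝ≥0∞)) =ᵐ[P] fun ω =>
      ∑' m : ℕ, ((Y (m * δ n + δ n) ω - Y (m * δ n) ω : ℕ) : ℝ≥0∞) * J n m ω := by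
    intro n
    filter_upwards [hY.zero, hY.monotone] with ω h0 hmono
    rw [hsum, ← Nat.cast_sum]
    congr 1
    have h1 : Monotone fun m : ℕ => Y (m * δ n) ω := fun a b hab => hmono (by gcongr)
    have h2 := Finset.sum_range_tsub h1 (⌊τ ω / δ n⌋₊ + 1)
    simp only [Nat.cast_add, Nat.cast_one, add_mul, one_mul, Nat.cast_zero, zero_mul, h0,
      tsub_zero] at h2
    rw [h2]
    simp only [hσ, add_mul, one_mul]
  have hσsum : ∀ n ω, (σ n ω : ℝ≥0∞) = ∑' m : ℕ, (δ n : ℝ≥0∞) * J n m ω := by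
    intro n ω
    rw [hsum]
    simp [hσ]
  have hcast : Measurable fun m : ℕ => (m : ℝ≥0∞) := measurable_from_top
  have hDm : ∀ a b : ℝ≥0, Measurable fun ω => ((Y b ω - Y a ω : ℕ) : ℝ≥0∞) := fun a b =>
    hcast.comp ((hY.measurable b).sub (hY.measurable a))
  have hDJ : ∀ n m : ℕ, AEMeasurable (fun ω =>
      ((Y (m * δ n + δ n) ω - Y (m * δ n) ω : ℕ) : ℝ≥0∞) * J n m ω) P := fun n m =>
    (hDm _ _).aemeasurable.mul (hJm n m)
  have hδJ : ∀ n m : ℕ, AEMeasurable (fun ω => (δ n : ℝ≥0∞) * J n m ω) P := fun n m =>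
    (hJm n m).const_mul _
  have hEq : ∀ n, ∫⁻ ω, (Y (σ n ω) ω : ℝ≥0∞) ∂P = ∫⁻ ω, σ n ω ∂P := by
    intro n
    rw [lintegral_congr_ae (hYσ n)]
    simp_rw [hσsum]
    rw [lintegral_tsum (hDJ n), lintegral_tsum (hδJ n)]
    refine tsum_congr fun m => ?_
    rw [lintegral_const_mul'' _ (hJm n m)]
    have h1 := lintegral_mul_eq_lintegral_mul_lintegral_of_indepFun''
      (hDm (m * δ n) (m * δ n + δ n)).aemeasurable (hJm n m)
      ((hind (m * δ n) (δ n)).comp (φ := fun m : ℕ => (m : ℝ≥0∞)) (ψ := id) hcast measurable_id)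
    rw [h1, hY.lintegral_increment]
    simp
  obtain ⟨W, hWi, hW0, hW⟩ := hY.exists_linear_bound
  have hWm : AEMeasurable (fun ω => ENNReal.ofReal (W ω)) P := hWi.aemeasurable.ennreal_ofReal
  have hτm : AEMeasurable (fun ω => (τ ω : ℝ≥0∞)) P := hτ.coe_nnreal_ennreal
  have hσm : ∀ n, AEMeasurable (fun ω => (σ n ω : ℝ≥0∞)) P := fun n => by
    simp_rw [hσsum]
    exact AEMeasurable.tsum (hδJ n)
  have hσt : ∀ ω, Tendsto (fun n => σ n ω) atTop (𝓝 (τ ω)) := fun ω =>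
    tendsto_of_tendsto_of_tendsto_of_le_of_le tendsto_const_nhds
      (by simpa using hδt.const_add (τ ω)) (fun n => hσ1 n ω) (fun n => hσ2 n ω)
  have hbound : ∀ n ω, (σ n ω : ℝ≥0∞) ≤ τ ω + 1 := fun n ω => by
    exact_mod_cast (hσ2 n ω).trans (by gcongr; exact hδ1 n)
  have hlim1 : Tendsto (fun n => ∫⁻ ω, (σ n ω : ℝ≥0∞) ∂P) atTop (𝓝 (∫⁻ ω, τ ω ∂P)) := by
    refine tendsto_lintegral_of_dominated_convergence' (fun ω => (τ ω : ℝ≥0∞) + 1) hσm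
      (fun n => Eventually.of_forall (hbound n)) ?_ (Eventually.of_forall fun ω =>
        ENNReal.tendsto_coe.2 (hσt ω))
    rw [lintegral_add_right' _ aemeasurable_const]
    simpa using hfin
  have hlim2 : Tendsto (fun n => ∫⁻ ω, (Y (σ n ω) ω : ℝ≥0∞) ∂P) atTop
      (𝓝 (∫⁻ ω, (Y (τ ω) ω : ℝ≥0∞) ∂P)) := by
    refine tendsto_lintegral_of_dominated_convergence'
      (fun ω => 2 * ((τ ω : ℝ≥0∞) + 1) + ENNReal.ofReal (W ω))
      (fun n => AEMeasurable.congr (AEMeasurable.tsum (hDJ n)) (hYσ n).symm) (fun n => ?_) ?_ ?_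
    · filter_upwards [hW] with ω hω
      have h1 : (Y (σ n ω) ω : ℝ≥0∞) ≤ ENNReal.ofReal (2 * σ n ω + W ω) := by
        rw [← ENNReal.ofReal_natCast]
        exact ENNReal.ofReal_le_ofReal (hω _)
      refine h1.trans ?_
      rw [ENNReal.ofReal_add (by positivity) (hW0 ω), ENNReal.ofReal_mul (by norm_num),
        ENNReal.ofReal_coe_nnreal, ENNReal.ofReal_ofNat]
      gcongr
      exact hbound n ω
    · rw [lintegral_add_left' (by fun_prop), lintegral_const_mul'' _ (by fun_prop),
        lintegral_add_right' _ aemeasurable_const]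
      refine ENNReal.add_ne_top.2 ⟨ENNReal.mul_ne_top (by simp)
        (ENNReal.add_ne_top.2 ⟨hfin, by simp⟩), ?_⟩
      rw [← ofReal_integral_eq_lintegral_ofReal hWi (Eventually.of_forall hW0)]
      exact ENNReal.ofReal_ne_top
    · filter_upwards [hY.right_continuous] with ω hω
      have h1 : Tendsto (fun n => σ n ω) atTop (𝓝[≥] (τ ω)) :=
        tendsto_nhdsWithin_iff.2 ⟨hσt ω, Eventually.of_forall fun n => hσ1 n ω⟩
      have h2 := (hω (τ ω)).tendsto.comp h1
      exact ((continuous_of_discreteTopology (f := fun m : ℕ => (m : ℝ≥0∞))).tendsto _).comp h2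
  simp_rw [hEq] at hlim2
  exact tendsto_nhds_unique hlim2 hlim1

end Poisson

/-! ### Gronwall bounds for paths under linear growth. -/

section Growth

open Filter Topology

theorem le_of_le_integral_affine {A : ℝ → ℝ} {a b T : ℝ} (hb : 0 < b)
    (hA : ContinuousOn A (Icc 0 T)) (h : ∀ t ∈ Icc 0 T, A t ≤ ∫ s in (0 : ℝ)..t, (a + b * A s)) :
    ∀ t ∈ Icc 0 T, A t ≤ a / b * (Real.exp (b * t) - 1) := by
  intro t ht
  have hT : 0 ≤ T := ht.1.trans ht.2
  -- Clamping time makes the integrand continuous on the whole line, so the right-hand side is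
  -- differentiable everywhere and the differential Gronwall inequality applies to it.
  set A' : ℝ → ℝ := fun s => A (max 0 (min s T)) with hA'
  have hA'c : Continuous A' := hA.comp_continuous (by fun_prop) fun s =>
    ⟨le_max_left _ _, max_le hT (min_le_right _ _)⟩
  have hAA' : ∀ s ∈ Icc 0 T, A' s = A s := fun s hs => by
    rw [hA']
    simp only [min_eq_left hs.2, max_eq_right hs.1]
  have hd : ∀ s, HasDerivAt (fun r => ∫ q in (0 : ℝ)..r, (a + b * A' q)) (a + b * A' s) s :=
    fun s => ((by fun_prop : Continuous fun q => a + b * A' q).integral_hasStrictDerivAt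
      0 s).hasDerivAt
  have hle : ∀ s ∈ Icc 0 T, A' s ≤ ∫ q in (0 : ℝ)..s, (a + b * A' q) := by
    intro s hs
    rw [hAA' s hs]
    refine (h s hs).trans_eq (intervalIntegral.integral_congr fun q hq => ?_)
    rw [uIcc_of_le hs.1] at hq
    simp only [hAA' q ⟨hq.1, hq.2.trans hs.2⟩]
  have := le_gronwallBound_of_liminf_deriv_right_le (δ := 0) (K := b) (ε := a) (a := 0) (b := T)
    (fun s _ => (hd s).continuousAt.continuousWithinAt)
    (fun s _ r hr => (hd s).hasDerivWithinAt.liminf_right_slope_le hr) (by simp)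
    (fun s hs => by nlinarith [hle s ⟨hs.1, hs.2.le⟩]) t ht
  rw [← hAA' t ht]
  refine (hle t ht).trans (this.trans_eq ?_)
  rw [gronwallBound_of_K_ne_0 hb.ne']
  simp

variable {ι E : Type*} [Fintype ι] [NormedAddCommGroup E] [NormedSpace ℝ E]

/-- Gronwall is applied to the sum of the clocks, which is continuous although `X` jumps. `K` is
chosen before the path, hence is deterministic, and the bound is linear in `V`, so it is integrable
whenever `V` is. -/
theorem exists_bound_of_linear_growth (T : ℝ) (C : ι → ℝ) (v : ι → E) (x₀ : E) :
    ∃ K : ℝ, 0 ≤ K ∧ ∀ (f : ι → ℝ → E → ℝ) (w : ι → ℝ≥0 → ℕ) (X : ℝ → E) (V : ℝ),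
      (∀ j, ∀ t ∈ Icc 0 T, ∀ x, |f j t x| ≤ C j * (1 + ‖x‖)) →
      (∀ j, ∀ t ∈ Icc 0 T, 0 ≤ f j t (X t)) →
      (∀ j, IntegrableOn (fun s => f j s (X s)) (Icc 0 T)) →
      (∀ r ∈ Icc 0 T, X r = x₀ + ∑ j, (w j (internalClock f X j r).toNNReal : ℝ) • v j) →
      0 ≤ V → (∀ j a, (w j a : ℝ) ≤ 2 * a + V) →
      ∀ t ∈ Icc 0 T, ‖X t‖ ≤ K * (1 + V) := by
  set c : ℝ := ∑ j, |C j| with hc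
  set L : ℝ := ∑ j, ‖v j‖ with hL
  have hc0 : 0 ≤ c := by positivity
  have hL0 : 0 ≤ L := by positivity
  -- The growth rate is `2 * c * L`; the extra `1` only keeps `b` positive for the division.
  set b : ℝ := 2 * c * L + 1 with hb
  have hb0 : 0 < b := by positivity
  set K₁ : ℝ := c * (1 + ‖x₀‖ + L) / b * Real.exp (b * T) with hK₁
  have hK₁0 : 0 ≤ K₁ := by positivity
  refine ⟨‖x₀‖ + 2 * L * K₁ + L, by positivity, ?_⟩
  intro f w X V hC h0 hi hX hV hw t ht
  have hT : 0 ≤ T := ht.1.trans ht.2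
  have hiT : ∀ j, IntervalIntegrable (fun s => f j s (X s)) volume 0 T := fun j =>
    (intervalIntegrable_iff_integrableOn_Icc_of_le hT).2 (hi j)
  set A : ℝ → ℝ := fun s => ∑ j, internalClock f X j s with hA
  have hτ0 : ∀ j, ∀ s ∈ Icc 0 T, 0 ≤ internalClock f X j s := fun j s hs =>
    intervalIntegral.integral_nonneg hs.1 fun q hq => h0 j q ⟨hq.1, hq.2.trans hs.2⟩
  have hτA : ∀ j, ∀ s ∈ Icc 0 T, internalClock f X j s ≤ A s := fun j s hs =>
    Finset.single_le_sum (f := fun j => internalClock f X j s) (fun j _ => hτ0 j s hs)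
      (Finset.mem_univ j)
  have hXA : ∀ s ∈ Icc 0 T, ‖X s‖ ≤ ‖x₀‖ + L * (2 * A s + V) := by
    intro s hs
    rw [hX s hs]
    refine (norm_add_le _ _).trans (add_le_add_right ((norm_sum_le _ _).trans ?_) _)
    rw [hL, Finset.sum_mul]
    refine Finset.sum_le_sum fun j _ => ?_
    rw [norm_smul, Real.norm_natCast, mul_comm]
    gcongr
    refine (hw j _).trans ?_
    rw [Real.coe_toNNReal _ (hτ0 j s hs)]
    linarith [hτA j s hs]
  have hAc : ContinuousOn A (Icc 0 T) :=
    continuousOn_finsetSum _ fun j _ => internalClock_continuousOn hT (hiT j)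
  have hrate : ∀ s ∈ Icc 0 T, ∑ j, f j s (X s) ≤ c * (1 + ‖x₀‖ + L * V) + b * A s := by
    intro s hs
    have hA0 : 0 ≤ A s := Finset.sum_nonneg fun j _ => hτ0 j s hs
    calc ∑ j, f j s (X s) ≤ ∑ j, |C j| * (1 + ‖X s‖) := Finset.sum_le_sum fun j _ =>
          (le_abs_self _).trans ((hC j s hs _).trans (by gcongr; exact le_abs_self _))
      _ = c * (1 + ‖X s‖) := by rw [hc, Finset.sum_mul]
      _ ≤ c * (1 + (‖x₀‖ + L * (2 * A s + V))) := by
          gcongr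
          exact hXA s hs
      _ ≤ c * (1 + ‖x₀‖ + L * V) + b * A s := by
          rw [hb]
          nlinarith
  have hint : ∀ s ∈ Icc 0 T, A s ≤ ∫ q in (0 : ℝ)..s, (c * (1 + ‖x₀‖ + L * V) + b * A q) := by
    intro s hs
    have his : ∀ j, IntervalIntegrable (fun s => f j s (X s)) volume 0 s := fun j =>
      (intervalIntegrable_iff_integrableOn_Icc_of_le hs.1).2
        ((hi j).mono_set (Icc_subset_Icc_right hs.2))
    have hAs : A s = ∫ q in (0 : ℝ)..s, ∑ j, f j q (X q) :=
      (intervalIntegral.integral_finsetSum fun j _ => his j).symm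
    rw [hAs]
    have hsum : IntervalIntegrable (fun q => ∑ j, f j q (X q)) volume 0 s := by
      have := IntervalIntegrable.sum Finset.univ (f := fun j q => f j q (X q)) fun j _ => his j
      rwa [Finset.sum_fn] at this
    refine intervalIntegral.integral_mono_on hs.1 hsum ?_
      fun q hq => hrate q ⟨hq.1, hq.2.trans hs.2⟩
    refine ContinuousOn.intervalIntegrable ?_
    rw [uIcc_of_le hs.1]
    exact (continuousOn_const.add (continuousOn_const.mul hAc)).mono (Icc_subset_Icc_right hs.2)
  have hAK : A t ≤ K₁ * (1 + V) := by
    refine (le_of_le_integral_affine hb0 hAc hint t ht).trans ?_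
    have h1 : Real.exp (b * t) - 1 ≤ Real.exp (b * T) := by
      have : Real.exp (b * t) ≤ Real.exp (b * T) := by
        gcongr
        exact ht.2
      linarith
    have h2 : c * (1 + ‖x₀‖ + L * V) ≤ c * (1 + ‖x₀‖ + L) * (1 + V) := by
      rw [mul_assoc]
      gcongr
      nlinarith [norm_nonneg x₀]
    calc c * (1 + ‖x₀‖ + L * V) / b * (Real.exp (b * t) - 1)
        ≤ c * (1 + ‖x₀‖ + L * V) / b * Real.exp (b * T) := by gcongr
      _ ≤ c * (1 + ‖x₀‖ + L) * (1 + V) / b * Real.exp (b * T) := by gcongr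
      _ = K₁ * (1 + V) := by rw [hK₁]; ring
  calc ‖X t‖ ≤ ‖x₀‖ + L * (2 * A t + V) := hXA t ht
    _ ≤ ‖x₀‖ + L * (2 * (K₁ * (1 + V)) + V) := by gcongr
    _ ≤ (‖x₀‖ + 2 * L * K₁ + L) * (1 + V) := by nlinarith [norm_nonneg x₀]

end Growth

/-! ### Optional stopping for real-valued integrable times. -/

section Expectation

open Filter Topology
open scoped ENNReal

variable {Ω : Type*} [MeasurableSpace Ω] {P : Measure Ω}

theorem IsPoissonProcess.aemeasurable_comp {Y : ℝ≥0 → Ω → ℕ} {r : ℝ≥0}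
    (hY : IsPoissonProcess Y r P) {τ : Ω → ℝ≥0} (hτ : AEMeasurable τ P) :
    AEMeasurable (fun ω => Y (τ ω) ω) P := by
  have hpath : Measurable fun ω t => Y t ω := measurable_pi_lambda _ hY.measurable
  refine (measurable_regularize.comp_aemeasurable (hτ.prodMk hpath.aemeasurable)).congr ?_
  filter_upwards [hY.monotone, hY.right_continuous] with ω h1 h2
  exact congrFun (regularize_eq_self h1 h2) (τ ω)

theorem IsPoissonProcess.integral_comp_eq [IsProbabilityMeasure P] {Y : ℝ≥0 → Ω → ℕ}
    (hY : IsPoissonProcess Y 1 P) {τ : Ω → ℝ} (hτ0 : ∀ᵐ ω ∂P, 0 ≤ τ ω) (hτi : Integrable τ P)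
    (hind : ∀ u h, IndepFun (fun ω => Y (u + h) ω - Y u ω)
      ({ω | u ≤ (τ ω).toNNReal}.indicator (1 : Ω → ℝ≥0∞)) P) :
    Integrable (fun ω => (Y (τ ω).toNNReal ω : ℝ)) P ∧
      ∫ ω, (Y (τ ω).toNNReal ω : ℝ) ∂P = ∫ ω, τ ω ∂P := by
  have hτm : AEMeasurable (fun ω => (τ ω).toNNReal) P := hτi.aemeasurable.real_toNNReal
  have hYm : AEMeasurable (fun ω => (Y (τ ω).toNNReal ω : ℝ)) P :=
    (measurable_from_top (f := fun m : ℕ => (m : ℝ))).comp_aemeasurable (hY.aemeasurable_comp hτm)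
  have hfin : ∫⁻ ω, ((τ ω).toNNReal : ℝ≥0∞) ∂P = ENNReal.ofReal (∫ ω, τ ω ∂P) :=
    (ofReal_integral_eq_lintegral_ofReal hτi hτ0).symm
  have h := hY.lintegral_comp_eq hτm hind (hfin ▸ ENNReal.ofReal_ne_top)
  have h' : ∫⁻ ω, ENNReal.ofReal (Y (τ ω).toNNReal ω : ℝ) ∂P = ENNReal.ofReal (∫ ω, τ ω ∂P) := by
    simp only [ENNReal.ofReal_natCast]
    exact h.trans hfin
  refine ⟨⟨hYm.aestronglyMeasurable, ?_⟩, ?_⟩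
  · rw [hasFiniteIntegral_iff_ofReal (Eventually.of_forall fun ω => Nat.cast_nonneg _), h']
    exact ENNReal.ofReal_lt_top
  · rw [integral_eq_lintegral_of_nonneg_ae (Eventually.of_forall fun ω => Nat.cast_nonneg _)
      hYm.aestronglyMeasurable, h', ENNReal.toReal_ofReal (integral_nonneg_of_ae hτ0)]

end Expectation

/-! ### The expectation identity. -/

theorem theorem3 {Ω : Type*} [MeasurableSpace Ω] (P : Measure Ω) [IsProbabilityMeasure P]
    {d k : ℕ} (T : ℝ) (x₀ : EuclideanSpace ℝ (Fin d)) (l : Fin k → Fin d → ℤ)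
    (f : Fin k → ℝ → EuclideanSpace ℝ (Fin d) → ℝ)
    (hf_cont : ∀ i, ContinuousOn (fun p : ℝ × EuclideanSpace ℝ (Fin d) => f i p.1 p.2)
      (Icc 0 T ×ˢ univ))
    (C : Fin k → ℝ)
    (hf_growth : ∀ i, ∀ t ∈ Icc 0 T, ∀ x, |f i t x| ≤ C i * (1 + ‖x‖))
    (Y : Fin k → ℝ≥0 → Ω → ℕ)
    (hY : ∀ i, IsPoissonProcess (Y i) 1 P)
    (hY_indep : iIndepFun (fun i ω t => Y i t ω) P)
    (X : ℝ → Ω → EuclideanSpace ℝ (Fin d))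
    (hX : IsTimeChangeSolution P T x₀ l f Y X) :
    ∀ t ∈ Icc 0 T,
      Integrable (X t) P ∧
      (∀ i, Integrable (fun ω => f i t (X t ω)) P) ∧
      (∀ i, IntervalIntegrable (fun s => ∫ ω, f i s (X s ω) ∂P) volume 0 t) ∧
      ∫ ω, X t ω ∂P =
        x₀ + ∑ i, (∫ s in (0 : ℝ)..t, ∫ ω, f i s (X s ω) ∂P) • intVec (l i) := by
  intro t ht
  have hT : 0 ≤ T := ht.1.trans ht.2
  set v : Fin k → EuclideanSpace ℝ (Fin d) := fun i => intVec (l i) with hv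
  have hmono : ∀ᵐ ω ∂P, ∀ i, Monotone fun s => Y i s ω := ae_all_iff.2 fun i => (hY i).monotone
  have hrc : ∀ᵐ ω ∂P, ∀ i a, ContinuousWithinAt (fun s => Y i s ω) (Ici a) a :=
    ae_all_iff.2 fun i => (hY i).right_continuous
  have hpath : Measurable fun ω i s => Y i s ω :=
    measurable_pi_lambda _ fun i => measurable_pi_lambda _ fun s => (hY i).measurable s
  -- a dominating integrable variable
  choose W hWi hW0 hW using fun i => (hY i).exists_linear_bound
  set V : Ω → ℝ := fun ω => ∑ i, W i ω with hV
  have hVi : Integrable V P := integrable_finsetSum _ fun i _ => hWi i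
  have hV0 : ∀ ω, 0 ≤ V ω := fun ω => Finset.sum_nonneg fun i _ => hW0 i ω
  obtain ⟨K, hK0, hK⟩ := exists_bound_of_linear_growth T C v x₀
  have hbound : ∀ᵐ ω ∂P, ∀ s ∈ Icc 0 T, ‖X s ω‖ ≤ K * (1 + V ω) := by
    filter_upwards [hX.rate_nonneg, hX.rate_integrable, hX.equation, ae_all_iff.2 hW] with
      ω h0 hi heq hWω
    refine hK f (fun i s => Y i s ω) (fun s => X s ω) (V ω) hf_growth h0 hi heq (hV0 ω) ?_
    intro i a
    exact (hWω i a).trans (add_le_add_right (Finset.single_le_sum (f := fun i => W i ω)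
      (fun i _ => hW0 i ω) (Finset.mem_univ i)) _)
  have hKVi : Integrable (fun ω => K * (1 + V ω)) P :=
    ((integrable_const _).add hVi).const_mul K
  have hfbound : ∀ᵐ ω ∂P, ∀ s ∈ Icc 0 T, ∀ i,
      ‖f i s (X s ω)‖ ≤ |C i| * (1 + K * (1 + V ω)) := by
    filter_upwards [hbound] with ω hω s hs i
    refine (hf_growth i s hs _).trans ?_
    gcongr
    · exact le_abs_self _
    · exact hω s hs
  have hCVi : ∀ i, Integrable (fun ω => |C i| * (1 + K * (1 + V ω))) P := fun i =>
    ((integrable_const _).add hKVi).const_mul _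
  have hfi : ∀ i, Integrable (fun ω => f i t (X t ω)) P := by
    intro i
    have hc : Continuous (f i t) :=
      (hf_cont i).comp_continuous (f := fun x => (t, x)) (by fun_prop) fun x => ⟨ht, trivial⟩
    exact (hCVi i).mono' (hc.measurable.comp (hX.measurable t ht)).aestronglyMeasurable
      (hfbound.mono fun ω hω => hω t ht i)
  -- joint integrability of the rates
  set μ : Measure ℝ := volume.restrict (Ioc 0 t) with hμ
  have hjoint : ∀ i, Integrable (fun p : ℝ × Ω => f i p.1 (X p.1 p.2)) (μ.prod P) := by
    intro i
    have hsnd : ∀ᵐ p ∂(μ.prod P), ∀ᶠ n in Filter.atTop, ∀ r ∈ Ico 0 t,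
        approxSolution (truncRate f T n) v x₀ (fun j => regularize fun s => Y j s p.2) n r =
          X r p.2 := by
      have : ∀ᵐ ω ∂P, ∀ᶠ n in Filter.atTop, ∀ r ∈ Ico 0 t,
          approxSolution (truncRate f T n) v x₀ (fun j => regularize fun s => Y j s ω) n r =
            X r ω := by
        filter_upwards [hX.rate_nonneg, hX.rate_integrable, hX.equation, hmono, hrc] with
          ω h0 hi heq h1 h2
        exact eventually_approxSolution_eq (w := fun j s => Y j s ω) hf_cont hf_growth h1 h2 h0 hi
          heq ht
      exact Measure.quasiMeasurePreserving_snd.ae this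
    -- The endpoint `t` is discarded because the reconstruction is exact only on `[0, t)`.
    have hfst : ∀ᵐ p ∂(μ.prod P), p.1 ∈ Ioo 0 t := by
      have : ∀ᵐ s ∂μ, s ∈ Ioo 0 t := by
        rw [hμ, ← restrict_Ioo_eq_restrict_Ioc]
        exact ae_restrict_mem measurableSet_Ioo
      exact Measure.quasiMeasurePreserving_fst.ae this
    -- Each `X s` is measurable by hypothesis, but Fubini needs joint measurability, which the
    -- reconstruction supplies.
    have hXm : AEMeasurable (fun p : ℝ × Ω => X p.1 p.2) (μ.prod P) := by
      refine aemeasurable_of_tendsto_metrizable_ae' (f := fun n p =>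
        approxSolution (truncRate f T n) v x₀ (fun j => regularize fun s => Y j s p.2) n p.1)
        (fun n => ?_) ?_
      · exact ((measurable_regularized_approxSolution hT hf_cont v x₀ n).comp
          (measurable_fst.prodMk (hpath.comp measurable_snd))).aemeasurable
      · filter_upwards [hsnd, hfst] with p hp hp1
        exact tendsto_nhds_of_eventually_eq (hp.mono fun n hn => hn _ ⟨hp1.1.le, hp1.2⟩)
    have hc : Continuous fun p : ℝ × EuclideanSpace ℝ (Fin d) => f i (max 0 (min p.1 T)) p.2 :=
      (hf_cont i).comp_continuous
        (f := fun p : ℝ × EuclideanSpace ℝ (Fin d) => (max 0 (min p.1 T), p.2)) (by fun_prop)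
        fun p => ⟨⟨le_max_left _ _, max_le hT (min_le_right _ _)⟩, trivial⟩
    have hfm : AEMeasurable (fun p : ℝ × Ω => f i p.1 (X p.1 p.2)) (μ.prod P) := by
      refine (hc.measurable.comp_aemeasurable
        (measurable_fst.aemeasurable.prodMk hXm)).congr ?_
      filter_upwards [hfst] with p hp
      simp only [Function.comp]
      rw [min_eq_left (hp.2.le.trans ht.2), max_eq_right hp.1.le]
    refine ((hCVi i).comp_snd μ).mono' hfm.aestronglyMeasurable ?_
    filter_upwards [Measure.quasiMeasurePreserving_snd.ae hfbound, hfst] with p hp hp1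
    exact hp p.1 ⟨hp1.1.le, hp1.2.le.trans ht.2⟩ i
  have hclock : ∀ i, Integrable (fun ω => internalClock f (fun s => X s ω) i t) P := by
    intro i
    simp only [internalClock, intervalIntegral.integral_of_le ht.1]
    exact (hjoint i).integral_prod_right
  have hswap : ∀ i, ∫ ω, internalClock f (fun s => X s ω) i t ∂P =
      ∫ s in (0 : ℝ)..t, ∫ ω, f i s (X s ω) ∂P := by
    intro i
    simp only [internalClock, intervalIntegral.integral_of_le ht.1]
    exact (integral_integral_swap (hjoint i)).symm
  have hclock0 : ∀ i, ∀ᵐ ω ∂P, 0 ≤ internalClock f (fun s => X s ω) i t := by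
    intro i
    filter_upwards [hX.rate_nonneg] with ω h0
    exact intervalIntegral.integral_nonneg ht.1 fun s hs => h0 i s ⟨hs.1, hs.2.trans ht.2⟩
  -- the internal clocks are stopping times
  have hind : ∀ i u h, IndepFun (fun ω => Y i (u + h) ω - Y i u ω)
      ({ω | u ≤ (internalClock f (fun s => X s ω) i t).toNNReal}.indicator
        (1 : Ω → ENNReal)) P := by
    intro i u h
    set B : Set (Fin k → ℝ≥0 → ℕ) := {w | ∀ᶠ n in Filter.atTop,
      u ≤ (approxClock f T v x₀ n i t w).toNNReal} with hB
    have hBm : MeasurableSet B := by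
      have hBe : B = ⋃ N, ⋂ n ≥ N, {w | u ≤ (approxClock f T v x₀ n i t w).toNNReal} := by
        ext w
        simp [hB, Filter.eventually_atTop]
      rw [hBe]
      exact MeasurableSet.iUnion fun N => MeasurableSet.iInter fun n =>
        MeasurableSet.iInter fun _ => measurableSet_le measurable_const
          (measurable_approxClock hT hf_cont v x₀ n i t).real_toNNReal
    have h1 := (indepFun_stopCoord_increment hY hY_indep i u h).symm.comp (φ := id)
      (ψ := B.indicator (1 : (Fin k → ℝ≥0 → ℕ) → ENNReal)) measurable_id
      (measurable_one.indicator hBm)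
    refine h1.congr Filter.EventuallyEq.rfl ?_
    filter_upwards [hX.rate_nonneg, hX.rate_integrable, hX.equation, hmono, hrc] with
      ω h0 hi heq hm hr
    have hmem : stopCoord i u (fun j s => Y j s ω) ∈ B ↔
        ω ∈ {ω | u ≤ (internalClock f (fun s => X s ω) i t).toNNReal} :=
      (le_internalClock_iff (w := fun j s => Y j s ω) hf_cont hf_growth hm hr h0 hi heq
        i u ht).symm
    by_cases hω : ω ∈ {ω | u ≤ (internalClock f (fun s => X s ω) i t).toNNReal}
    · rw [Function.comp, indicator_of_mem (hmem.2 hω), indicator_of_mem hω]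
      rfl
    · rw [Function.comp, indicator_of_notMem (mt hmem.1 hω), indicator_of_notMem hω]
  have hN := fun i => (hY i).integral_comp_eq (hclock0 i) (hclock i) (hind i)
  refine ⟨?_, hfi, fun i => ?_, ?_⟩
  · exact hKVi.mono' (hX.measurable t ht).aestronglyMeasurable
      (hbound.mono fun ω hω => hω t ht)
  · rw [intervalIntegrable_iff_integrableOn_Ioc_of_le ht.1]
    exact (hjoint i).integral_prod_left
  · have hXt : X t =ᵐ[P] fun ω => x₀ + ∑ i,
        (Y i (internalClock f (fun s => X s ω) i t).toNNReal ω : ℝ) • v i := by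
      filter_upwards [hX.equation] with ω hω
      exact hω t ht
    rw [integral_congr_ae hXt, integral_add (integrable_const _)
      (integrable_finsetSum _ fun i _ => (hN i).1.smul_const _),
      integral_finsetSum _ fun i _ => (hN i).1.smul_const _]
    simp only [integral_const, probReal_univ, one_smul, integral_smul_const, (hN _).2, hswap, hv]
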